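/- Let $G$ be a finite graph. A \emph{matching} is a set of pairwise disjoint edges, a \emph{maximum matching} is a matching with the greatest number of edges, and $\nu(G)$ is the size of a maximum matching; write $\operatorname{def}(G)=|V(G)|-2\nu(G)$. A graph is \emph{factor-critical} if for each of its vertices $v$ it has a matching covering exactly the vertices other than $v$. For $X\subseteq V(G)$, let $G[X]$ be the subgraph induced by $X$, let $G/X$ be the graph obtained by contracting $X$ to a single vertex, and let $\Gamma(X)$ be the set of vertices outside $X$ that are joined to a vertex of $X$. An edge is \emph{allowed} if some maximum matching contains it. The \emph{factor-components} of $G$ are the subgraphs of $G$ induced by the vertex sets of the connected components of the spanning subgraph formed by the allowed edges. For factor-components $H, I$ write $H\lhd I$ if there is a set $X\supseteq V(H)\cup V(I)$ which is a union of vertex sets of factor-components and for which $G[X]/V(H)$ is factor-critical. Let $U(H)$ be the union of the vertex sets $V(I)$ over all factor-components $I\neq H$ with $H\lhd I$. For $u,v\in V(G)$ write $u\sim_G v$ if $u=v$, or if $u$ and $v$ lie in the same factor-component and $\operatorname{def}(G-u-v)>\operatorname{def}(G)$. This is an equivalence relation; its classes form the generalized Kotzig--Lov\'asz partition, and each class is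 contained in a factor-component. Let $H$ be a factor-component of $G$ and let $S\subseteq V(H)$ be an equivalence class of $\sim_G$. Let $K_1,\dots,K_l$ be all the connected components $K$ of $G[U(H)]$ such that $\Gamma(V(K))\cap V(H)\subseteq S$. Then the graph $$G[V(K_1)\cup\cdots\cup V(K_l)\cup S]/S$$ is factor-critical. -/

import Mathlib

open SimpleGraph

namespace Basilica

variable {V : Type*}

/-- A matching `M` exposes `v` when `v ∉ M.verts`; a near-perfect matching exposing `v` has
vertex set `{v}ᶜ`. A graph is factor-critical if for every vertex there is such a matching. -/
def IsFactorCritical (G : SimpleGraph V) : Prop :=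
  ∀ v : V, ∃ M : G.Subgraph, M.IsMatching ∧ M.verts = {v}ᶜ

/-- A matching with the greatest number of edges. -/
def IsMaximumMatching (G : SimpleGraph V) (M : G.Subgraph) : Prop :=
  M.IsMatching ∧ ∀ M' : G.Subgraph, M'.IsMatching → M'.edgeSet.ncard ≤ M.edgeSet.ncard

/-- The contraction `G / X`: the vertices outside `X` together with one new vertex `none`,
which replaces `X`. -/
def contract (G : SimpleGraph V) (X : Set V) : SimpleGraph (Option ↥Xᶜ) where
  Adj a b :=
    match a, b with
    | some u, some v => G.Adj u v
    | some u, none => ∃ x ∈ X, G.Adj u x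
    | none, some v => ∃ x ∈ X, G.Adj x v
    | none, none => False
  symm := ⟨by
    rintro (_ | u) (_ | v) h
    · exact h
    · obtain ⟨x, hx, hxv⟩ := h
      exact ⟨x, hx, hxv.symm⟩
    · obtain ⟨x, hx, hux⟩ := h
      exact ⟨x, hx, hux.symm⟩
    · exact G.adj_symm h⟩
  loopless := ⟨by
    rintro (_ | u) h
    · exact h
    · exact G.loopless.irrefl _ h⟩

/-- `G[Y] / X`, intended for `X ⊆ Y`. -/
def contractIn (G : SimpleGraph V) (Y X : Set V) :
    SimpleGraph (Option ↥((Subtype.val ⁻¹' X : Set ↥Y)ᶜ)) :=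
  contract (G.induce Y) (Subtype.val ⁻¹' X)

/-- The set of neighbours of `X`: vertices outside `X` joined to a vertex in `X`. -/
def nbrs (G : SimpleGraph V) (X : Set V) : Set V :=
  {v | v ∉ X ∧ ∃ x ∈ X, G.Adj x v}

/-- The spanning subgraph formed by the allowed edges, i.e. the edges that lie in some
maximum matching. -/
def allowedGraph (G : SimpleGraph V) : SimpleGraph V where
  Adj u v := ∃ M : G.Subgraph, IsMaximumMatching G M ∧ M.Adj u v
  symm := ⟨fun _ _ ⟨M, hM, h⟩ => ⟨M, hM, h.symm⟩⟩
  loopless := ⟨fun _ ⟨_, _, h⟩ => h.ne rfl⟩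

/-- A factor-component is the subgraph of `G` induced by a connected component of the graph of
allowed edges; it is represented by that component, its vertex set being `H.supp`. -/
abbrev FactorComponent (G : SimpleGraph V) : Type _ :=
  (allowedGraph G).ConnectedComponent

/-- A separating set: the union of the vertex sets of one or more factor-components. -/
def IsSeparating (G : SimpleGraph V) (X : Set V) : Prop :=
  ∃ F : Set (FactorComponent G), F.Nonempty ∧ X = ⋃ H ∈ F, H.supp

/-- A critical-inducing set for the factor-component `H`. -/
def IsCriticalInducing (G : SimpleGraph V) (H : FactorComponent G) (X : Set V) : Prop :=
  IsSeparating G X ∧ H.supp ⊆ X ∧ IsFactorCritical (contractIn G X H.supp)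

/-- The basilica order: `H ◁ I` if there is a critical-inducing set for `H` to `I`. -/
def Yields (G : SimpleGraph V) (H I : FactorComponent G) : Prop :=
  ∃ X : Set V, IsCriticalInducing G H X ∧ I.supp ⊆ X

/-- The strict upper bounds of `H`. -/
def strictUp (G : SimpleGraph V) (H : FactorComponent G) : Set (FactorComponent G) :=
  {I | Yields G H I} \ {H}

/-- The vertices of the strict upper bounds of `H`. -/
def strictUpVerts (G : SimpleGraph V) (H : FactorComponent G) : Set V :=
  ⋃ I ∈ strictUp G H, I.supp

/-- The size of a maximum matching. -/
noncomputable def matchingNumber (G : SimpleGraph V) : ℕ :=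
  sSup {n | ∃ M : G.Subgraph, M.IsMatching ∧ M.edgeSet.ncard = n}

/-- The deficiency `|V(G)| - 2 ν(G)`. -/
noncomputable def deficiency (G : SimpleGraph V) : ℤ :=
  (Nat.card V : ℤ) - 2 * (matchingNumber G : ℤ)

/-- `u ∼ v` if `u = v`, or `u` and `v` lie in the same factor-component and
`def(G - u - v) > def(G)`. -/
def KLRel (G : SimpleGraph V) (u v : V) : Prop :=
  u = v ∨
    ((allowedGraph G).connectedComponentMk u = (allowedGraph G).connectedComponentMk v ∧
      deficiency G < deficiency (G.induce ({u, v}ᶜ : Set V)))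

/-- The generalized Kotzig–Lovász decomposition: the classes of `KLRel G`. -/
def klClasses (G : SimpleGraph V) : Set (Set V) :=
  {S | ∃ u : V, S = {v | KLRel G u v}}

/-- The classes of the generalized Kotzig–Lovász decomposition contained in `H`. -/
def klPartition (G : SimpleGraph V) (H : FactorComponent G) : Set (Set V) :=
  {S | S ∈ klClasses G ∧ S ⊆ H.supp}

/-- The union of the vertex sets of all connected components `K` of `G[strictUpVerts G H]`
with `Γ(K) ∩ V(H) ⊆ S`. -/
def attachedVerts (G : SimpleGraph V) (H : FactorComponent G) (S : Set V) : Set V :=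
  ⋃ K ∈ {K : (G.induce (strictUpVerts G H)).ConnectedComponent |
      nbrs G (Subtype.val '' K.supp) ∩ H.supp ⊆ S}, Subtype.val '' K.supp

end Basilica

namespace Basilica

variable {V : Type*}

/-- `G` has a matching covering exactly the vertices in `Z`. -/
def MatchesOnto (G : SimpleGraph V) (Z : Set V) : Prop :=
  ∃ M : G.Subgraph, M.IsMatching ∧ M.verts = Z

theorem matchesOnto_of_rel {G : SimpleGraph V} {Z : Set V} (R : V → V → Prop)
    (hsymm : ∀ u v, R u v → R v u) (hadj : ∀ u v, R u v → G.Adj u v)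
    (huniq : ∀ u v w, R u v → R u w → v = w) (hdom : ∀ u, u ∈ Z ↔ ∃ v, R u v) :
    MatchesOnto G Z := by
  refine ⟨⟨Z, R, fun h => hadj _ _ h, fun h => (hdom _).2 ⟨_, h⟩, ⟨hsymm⟩⟩, ?_, rfl⟩
  intro u hu
  obtain ⟨v, hv⟩ := (hdom u).1 hu
  exact ⟨v, hv, fun w hw => huniq u w v hw hv⟩

theorem matchesOnto_inter {G : SimpleGraph V} {M : G.Subgraph} (hM : M.IsMatching) (C : Set V)
    (hC : ∀ u v, u ∈ C → M.Adj u v → v ∈ C) : MatchesOnto G (M.verts ∩ C) := by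
  refine matchesOnto_of_rel (fun u v => M.Adj u v ∧ u ∈ C) ?_ ?_ ?_ ?_
  · exact fun u v h => ⟨h.1.symm, hC u v h.2 h.1⟩
  · exact fun u v h => h.1.adj_sub
  · exact fun u v w h h' => hM.eq_of_adj_left h.1 h'.1
  · intro u
    constructor
    · rintro ⟨hu, huC⟩
      obtain ⟨v, hv, -⟩ := hM hu
      exact ⟨v, hv, huC⟩
    · rintro ⟨v, hv, huC⟩
      exact ⟨M.edge_vert hv, huC⟩

theorem MatchesOnto.union {G : SimpleGraph V} {Y Z : Set V} (hY : MatchesOnto G Y)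
    (hZ : MatchesOnto G Z) (hd : Disjoint Y Z) : MatchesOnto G (Y ∪ Z) := by
  obtain ⟨M, hM, rfl⟩ := hY
  obtain ⟨N, hN, rfl⟩ := hZ
  refine ⟨M ⊔ N, hM.sup hN ?_, rfl⟩
  rwa [hM.support_eq_verts, hN.support_eq_verts]

theorem MatchesOnto.even_ncard [Finite V] {G : SimpleGraph V} {Z : Set V}
    (hZ : MatchesOnto G Z) : Even Z.ncard := by
  classical
  obtain ⟨M, hM, rfl⟩ := hZ
  have := Fintype.ofFinite V
  have := hM.even_card
  rwa [← Set.ncard_eq_toFinset_card'] at this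

/-- Handshake count: degrees in `M.spanningCoe` are 1 on `M.verts` and 0 elsewhere. -/
theorem ncard_verts_eq_two_mul_ncard_edgeSet [Finite V] {G : SimpleGraph V} {M : G.Subgraph}
    (hM : M.IsMatching) : M.verts.ncard = 2 * M.edgeSet.ncard := by
  classical
  have := Fintype.ofFinite V
  have h := M.spanningCoe.sum_degrees_eq_twice_card_edges
  have hdeg : ∀ v, M.spanningCoe.degree v = if v ∈ M.verts then 1 else 0 := by
    intro v
    split_ifs with hv
    · rw [SimpleGraph.degree_eq_one_iff_existsUnique_adj]
      exact hM hv
    · rw [SimpleGraph.degree_eq_zero]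
      intro w hw
      exact hv (M.edge_vert hw)
  simp only [hdeg, Finset.sum_boole] at h
  rw [Set.ncard_eq_toFinset_card', Set.ncard_eq_toFinset_card']
  have h1 : M.verts.toFinset = Finset.univ.filter (· ∈ M.verts) := by ext; simp
  have h2 : M.edgeSet.toFinset = M.spanningCoe.edgeFinset := by ext; simp
  rw [h1, h2]
  exact_mod_cast h

theorem exists_isMaximumMatching [Finite V] (G : SimpleGraph V) :
    ∃ M : G.Subgraph, IsMaximumMatching G M := by
  obtain ⟨M, hM, hmax⟩ := Set.exists_max_image {M : G.Subgraph | M.IsMatching}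
    (fun M => M.edgeSet.ncard) (Set.toFinite _) ⟨⊥, by intro v hv; simp at hv⟩
  exact ⟨M, hM, hmax⟩

/-- A maximum matching covers every set that can be matched onto and that it does not leave. -/
theorem IsMaximumMatching.subset_verts [Finite V] {G : SimpleGraph V} {M : G.Subgraph}
    (hM : IsMaximumMatching G M) {Z : Set V} (hZ : MatchesOnto G Z)
    (hclosed : ∀ u v, u ∈ Z → M.Adj u v → v ∈ Z) : Z ⊆ M.verts := by
  -- Exchange: no edge of `M` crosses the boundary of `Z`, so its part inside can be replaced by a
  -- perfect matching of `Z`.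
  have hrest := matchesOnto_inter hM.1 Zᶜ (fun u v hu huv hv => hu (hclosed v u hv huv.symm))
  obtain ⟨N, hN, hNv⟩ := hZ.union hrest
    (Set.disjoint_left.2 fun v hv hv' => hv'.2 hv)
  have hle := hM.2 N hN
  have h1 := ncard_verts_eq_two_mul_ncard_edgeSet hM.1
  have h2 := ncard_verts_eq_two_mul_ncard_edgeSet hN
  have hsub : M.verts ⊆ N.verts := by
    intro v hv
    rw [hNv]
    by_cases h : v ∈ Z
    · exact Or.inl h
    · exact Or.inr ⟨hv, h⟩
  rw [Set.eq_of_subset_of_ncard_le hsub (by omega), hNv]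
  exact Set.subset_union_left

/-! ### Matchings of a contraction -/

/-- Factor-criticality of `G[Y] / X` in terms of matchings of `G`. -/
theorem isFactorCritical_contractIn_iff {G : SimpleGraph V} {X Y : Set V} (hXY : X ⊆ Y) :
    IsFactorCritical (contractIn G Y X) ↔ MatchesOnto G (Y \ X) ∧
      ∀ x ∈ Y \ X, ∃ y ∈ Y \ X, y ≠ x ∧ (∃ a ∈ X, G.Adj y a) ∧
        MatchesOnto G ((Y \ X) \ {x, y}) := by
  set e : ↥((Subtype.val ⁻¹' X : Set ↥Y)ᶜ) → V := fun a => a.1.1 with he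
  have einj : Function.Injective e := fun a b h => Subtype.ext (Subtype.ext h)
  have emem : ∀ a, e a ∈ Y \ X := fun a => ⟨a.1.2, a.2⟩
  have esurj : ∀ v ∈ Y \ X, ∃ a, e a = v := fun v hv => ⟨⟨⟨v, hv.1⟩, hv.2⟩, rfl⟩
  -- Transfers a matching of the contraction to `G`, dropping the edge at `none`.
  have push : ∀ N : (contractIn G Y X).Subgraph, N.IsMatching → ∀ Z : Set V,
      (∀ v, v ∈ Z ↔ ∃ a b, e a = v ∧ N.Adj (some a) (some b)) → MatchesOnto G Z := by
    intro N hN Z hZ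
    refine matchesOnto_of_rel
      (fun u v => ∃ a b, e a = u ∧ e b = v ∧ N.Adj (some a) (some b)) ?_ ?_ ?_ ?_
    · rintro _ _ ⟨a, b, rfl, rfl, h⟩
      exact ⟨b, a, rfl, rfl, h.symm⟩
    · rintro _ _ ⟨a, b, rfl, rfl, h⟩
      exact h.adj_sub
    · rintro _ _ _ ⟨a, b, rfl, rfl, h⟩ ⟨a', c, ha, rfl, h'⟩
      obtain rfl := einj ha
      exact congrArg e (Option.some_injective _ (hN.eq_of_adj_left h h'))
    · intro u
      rw [hZ]
      constructor
      · rintro ⟨a, b, rfl, h⟩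
        exact ⟨e b, a, b, rfl, rfl, h⟩
      · rintro ⟨_, a, b, rfl, rfl, h⟩
        exact ⟨a, b, rfl, h⟩
  constructor
  · intro hfc
    constructor
    · obtain ⟨N, hN, hNv⟩ := hfc none
      refine push N hN _ fun v => ⟨fun hv => ?_, ?_⟩
      · obtain ⟨a, rfl⟩ := esurj v hv
        obtain ⟨b, hb, -⟩ := hN (show some a ∈ N.verts by simp [hNv])
        have hbv := N.edge_vert hb.symm
        cases b with
        | none => simp [hNv] at hbv
        | some b => exact ⟨a, b, rfl, hb⟩
      · rintro ⟨a, b, rfl, -⟩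
        exact emem a
    · intro x hx
      obtain ⟨x, rfl⟩ := esurj x hx
      obtain ⟨N, hN, hNv⟩ := hfc (some x)
      obtain ⟨y, hy, -⟩ := hN (show none ∈ N.verts by simp [hNv])
      have hyv := N.edge_vert hy.symm
      cases y with
      | none => exact (N.loopless.irrefl _ hy).elim
      | some y =>
        have hyx : y ≠ x := by
          rintro rfl
          simp [hNv] at hyv
        refine ⟨e y, emem y, fun h => hyx (einj h), ?_, ?_⟩
        · obtain ⟨a, ha, hay⟩ := hy.adj_sub
          exact ⟨a.1, ha, hay.symm⟩
        · refine push N hN _ fun v => ⟨fun hv => ?_, ?_⟩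
          · obtain ⟨a, rfl⟩ := esurj v hv.1
            have hax : a ≠ x := by
              rintro rfl
              exact hv.2 (Or.inl rfl)
            obtain ⟨b, hb, -⟩ := hN (show some a ∈ N.verts by simpa [hNv] using hax)
            cases b with
            | none =>
              refine (hv.2 (Or.inr ?_)).elim
              exact congrArg e (Option.some_injective _ (hN.eq_of_adj_left hb.symm hy))
            | some b => exact ⟨a, b, rfl, hb⟩
          · rintro ⟨a, b, rfl, hab⟩
            refine ⟨emem a, ?_⟩
            rintro (h | h)
            · obtain rfl := einj h
              have := N.edge_vert hab
              simp [hNv] at this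
            · obtain rfl := einj h
              cases hN.eq_of_adj_left hab hy.symm
  · rintro ⟨⟨M, hM, hMv⟩, hx⟩
    rintro (_ | x)
    · refine matchesOnto_of_rel (fun u v => ∃ a b, some a = u ∧ some b = v ∧ M.Adj (e a) (e b))
        ?_ ?_ ?_ ?_
      · rintro _ _ ⟨a, b, rfl, rfl, h⟩
        exact ⟨b, a, rfl, rfl, h.symm⟩
      · rintro _ _ ⟨a, b, rfl, rfl, h⟩
        exact h.adj_sub
      · rintro _ _ _ ⟨a, b, rfl, rfl, h⟩ ⟨a', c, ha, rfl, h'⟩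
        obtain rfl := Option.some_injective _ ha
        rw [einj (hM.eq_of_adj_left h h')]
      · rintro (_ | u)
        · simp
        · simp only [Set.mem_compl_iff, Set.mem_singleton_iff, reduceCtorEq, not_false_eq_true,
            true_iff]
          obtain ⟨w, hw, -⟩ := hM (show e u ∈ M.verts by rw [hMv]; exact emem u)
          have hwv := M.edge_vert hw.symm
          rw [hMv] at hwv
          obtain ⟨b, rfl⟩ := esurj w hwv
          exact ⟨some b, u, b, rfl, rfl, hw⟩
    · obtain ⟨y, hy, hyx, ⟨s, hs, hys⟩, N, hN, hNv⟩ := hx (e x) (emem x)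
      obtain ⟨y, rfl⟩ := esurj y hy
      have hyN : ∀ v, ¬ N.Adj (e y) v := by
        intro v hv
        have := N.edge_vert hv
        rw [hNv] at this
        exact this.2 (Or.inr rfl)
      -- `N` together with the edge from the contracted vertex to `y`.
      refine matchesOnto_of_rel (fun u v =>
        (∃ a b, some a = u ∧ some b = v ∧ N.Adj (e a) (e b)) ∨ (u = none ∧ v = some y) ∨
          (u = some y ∧ v = none)) ?_ ?_ ?_ ?_
      · rintro _ _ (⟨a, b, rfl, rfl, h⟩ | ⟨rfl, rfl⟩ | ⟨rfl, rfl⟩)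
        · exact Or.inl ⟨b, a, rfl, rfl, h.symm⟩
        · exact Or.inr (Or.inr ⟨rfl, rfl⟩)
        · exact Or.inr (Or.inl ⟨rfl, rfl⟩)
      · rintro _ _ (⟨a, b, rfl, rfl, h⟩ | ⟨rfl, rfl⟩ | ⟨rfl, rfl⟩)
        · exact h.adj_sub
        · exact ⟨⟨s, hXY hs⟩, hs, hys.symm⟩
        · exact ⟨⟨s, hXY hs⟩, hs, hys⟩
      · rintro _ _ _ (⟨a, b, rfl, rfl, h⟩ | ⟨rfl, rfl⟩ | ⟨rfl, rfl⟩)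
          (⟨a', c, ha, rfl, h'⟩ | ⟨ha, rfl⟩ | ⟨ha, rfl⟩)
        · obtain rfl := Option.some_injective _ ha
          rw [einj (hN.eq_of_adj_left h h')]
        · cases ha
        · obtain rfl := Option.some_injective _ ha
          exact (hyN _ h).elim
        · cases ha
        · rfl
        · cases ha
        · obtain rfl := Option.some_injective _ ha
          exact (hyN _ h').elim
        · cases ha
        · rfl
      · rintro (_ | u)
        · simp
        · constructor
          · intro hu
            by_cases huy : u = y
            · exact ⟨none, Or.inr (Or.inr ⟨by rw [huy], rfl⟩)⟩
            have hux : u ≠ x := by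
              rintro rfl
              exact hu rfl
            obtain ⟨w, hw, -⟩ := hN (show e u ∈ N.verts by
              rw [hNv]
              refine ⟨emem u, ?_⟩
              rintro (h | h)
              · exact hux (einj h)
              · exact huy (einj h))
            have hwv := N.edge_vert hw.symm
            rw [hNv] at hwv
            obtain ⟨b, rfl⟩ := esurj w hwv.1
            exact ⟨some b, Or.inl ⟨u, b, rfl, rfl, hw⟩⟩
          · rintro ⟨w, ⟨a, b, ha, rfl, h⟩ | ⟨h, -⟩ | ⟨h, -⟩⟩ hux
            · obtain rfl := Option.some_injective _ ha
              obtain rfl := Option.some_injective _ hux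
              have := N.edge_vert h
              rw [hNv] at this
              exact this.2 (Or.inl rfl)
            · cases h
            · obtain rfl := Option.some_injective _ h
              obtain rfl := Option.some_injective _ hux
              exact hyx rfl

/-! ### Closure properties of separating sets and attached components -/

theorem IsMaximumMatching.connectedComponentMk_eq {G : SimpleGraph V} {M : G.Subgraph}
    (hM : IsMaximumMatching G M) {u v : V} (h : M.Adj u v) :
    (allowedGraph G).connectedComponentMk u = (allowedGraph G).connectedComponentMk v :=
  ConnectedComponent.sound (Adj.reachable (G := allowedGraph G) ⟨M, hM, h⟩)

theorem IsSeparating.mem_of_connectedComponentMk_eq {G : SimpleGraph V} {X : Set V}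
    (hX : IsSeparating G X) {u v : V} (hu : u ∈ X)
    (h : (allowedGraph G).connectedComponentMk u = (allowedGraph G).connectedComponentMk v) :
    v ∈ X := by
  obtain ⟨F, -, rfl⟩ := hX
  simp only [Set.mem_iUnion, ConnectedComponent.mem_supp_iff, exists_prop] at hu ⊢
  obtain ⟨I, hI, rfl⟩ := hu
  exact ⟨_, hI, h.symm⟩

theorem mem_strictUpVerts_iff {G : SimpleGraph V} {H : FactorComponent G} {v : V} :
    v ∈ strictUpVerts G H ↔ v ∉ H.supp ∧ ∃ X, IsCriticalInducing G H X ∧ v ∈ X := by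
  simp only [strictUpVerts, Set.mem_iUnion, exists_prop]
  constructor
  · rintro ⟨I, ⟨⟨X, hX, hIX⟩, hne⟩, hv⟩
    refine ⟨fun hH => hne ?_, X, hX, hIX hv⟩
    exact hv.symm.trans hH
  · rintro ⟨hv, X, hX, hvX⟩
    refine ⟨(allowedGraph G).connectedComponentMk v, ⟨⟨X, hX, ?_⟩, fun h => hv h⟩, rfl⟩
    exact fun w hw => hX.1.mem_of_connectedComponentMk_eq hvX
      (((allowedGraph G).connectedComponentMk v).mem_supp_iff w |>.1 hw).symm

theorem attachedVerts_subset {G : SimpleGraph V} {H : FactorComponent G} {S : Set V} :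
    attachedVerts G H S ⊆ strictUpVerts G H := by
  intro v hv
  simp only [attachedVerts, Set.mem_iUnion] at hv
  obtain ⟨K, -, w, -, rfl⟩ := hv
  exact w.2

theorem mem_attachedVerts_of_adj {G : SimpleGraph V} {H : FactorComponent G} {S : Set V} {u v : V}
    (hu : u ∈ attachedVerts G H S) (hv : v ∈ strictUpVerts G H) (h : G.Adj u v) :
    v ∈ attachedVerts G H S := by
  simp only [attachedVerts, Set.mem_iUnion] at hu ⊢
  obtain ⟨K, hK, w, hw, rfl⟩ := hu
  refine ⟨K, hK, ⟨v, hv⟩, ?_, rfl⟩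
  exact K.mem_supp_of_adj_mem_supp hw h

theorem mem_of_adj_attachedVerts {G : SimpleGraph V} {H : FactorComponent G} {S : Set V} {u v : V}
    (hu : u ∈ attachedVerts G H S) (hv : v ∈ H.supp) (h : G.Adj u v) : v ∈ S := by
  simp only [attachedVerts, Set.mem_iUnion] at hu
  obtain ⟨K, hK, w, hw, rfl⟩ := hu
  refine hK ⟨⟨?_, _, ⟨w, hw, rfl⟩, h⟩, hv⟩
  rintro ⟨z, -, rfl⟩
  exact (mem_strictUpVerts_iff.1 z.2).1 hv

/-- The contraction of `S` in `G[attachedVerts G H S ∪ S]` is factor-critical for every set `S` of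
vertices of `H`. -/
theorem isFactorCritical_contractIn_attachedVerts [Finite V] (G : SimpleGraph V)
    (H : FactorComponent G) (S : Set V) (hS : S ⊆ H.supp) :
    IsFactorCritical (contractIn G (attachedVerts G H S ∪ S) S) := by
  set A := attachedVerts G H S with hA
  have hAH : ∀ v ∈ A, v ∉ H.supp := fun v hv =>
    (mem_strictUpVerts_iff.1 (attachedVerts_subset hv)).1
  have hAS : (A ∪ S) \ S = A := by
    ext v
    exact ⟨fun h => h.1.resolve_right h.2, fun h => ⟨Or.inl h, fun hs => hAH v h (hS hs)⟩⟩
  obtain ⟨M, hM⟩ := exists_isMaximumMatching G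
  have hMX : ∀ X, IsCriticalInducing G H X → ∀ u v, u ∈ X → M.Adj u v → v ∈ X :=
    fun X hX u v hu h =>
      hX.1.mem_of_connectedComponentMk_eq hu (hM.connectedComponentMk_eq h)
  have hMH : ∀ u v, M.Adj u v → u ∈ H.supp → v ∈ H.supp := by
    intro u v h hu
    rw [ConnectedComponent.mem_supp_iff] at hu ⊢
    rw [← hM.connectedComponentMk_eq h, hu]
  have hMcover : ∀ X, IsCriticalInducing G H X → X \ H.supp ⊆ M.verts := by
    intro X hX
    refine hM.subset_verts ((isFactorCritical_contractIn_iff hX.2.1).1 hX.2.2).1 ?_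
    exact fun u v hu h => ⟨hMX X hX u v hu.1 h, fun hv => hu.2 (hMH v u h.symm hv)⟩
  have hMA : ∀ u v, u ∈ A → M.Adj u v → v ∈ A := by
    intro u v hu h
    obtain ⟨huH, X, hX, huX⟩ := mem_strictUpVerts_iff.1 (attachedVerts_subset hu)
    refine mem_attachedVerts_of_adj hu (mem_strictUpVerts_iff.2 ⟨?_, X, hX, ?_⟩) h.adj_sub
    · exact fun hv => huH (hMH v u h.symm hv)
    · exact hMX X hX u v huX h
  have hAM : A ⊆ M.verts := by
    intro v hv
    obtain ⟨hvH, X, hX, hvX⟩ := mem_strictUpVerts_iff.1 (attachedVerts_subset hv)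
    exact hMcover X hX ⟨hvX, hvH⟩
  rw [isFactorCritical_contractIn_iff Set.subset_union_right, hAS]
  refine ⟨by simpa [Set.inter_eq_right.2 hAM] using matchesOnto_inter hM.1 A hMA, ?_⟩
  intro x hx
  obtain ⟨hxH, X, hX, hxX⟩ := mem_strictUpVerts_iff.1 (attachedVerts_subset hx)
  obtain ⟨y, ⟨hyX, hyH⟩, hyx, ⟨a, ha, hya⟩, N, hN, hNv⟩ :=
    ((isFactorCritical_contractIn_iff hX.2.1).1 hX.2.2).2 x ⟨hxX, hxH⟩
  -- `N` lives on `X \ H`, inside `U(H)`, so none of its edges leaves `A`.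
  have hNA := matchesOnto_inter hN A (by
    intro u v hu h
    have hv := N.edge_vert h.symm
    rw [hNv] at hv
    exact mem_attachedVerts_of_adj hu (mem_strictUpVerts_iff.2 ⟨hv.1.2, X, hX, hv.1.1⟩) h.adj_sub)
  have hMAX := matchesOnto_inter hM.1 (A ∩ X)
    (fun u v hu h => ⟨hMA u v hu.1 h, hMX X hX u v hu.2 h⟩)
  rw [Set.inter_eq_right.2 (Set.inter_subset_left.trans hAM)] at hMAX
  have hyA : y ∈ A := by
    by_contra hyA
    -- If `y ∉ A`, then `N` covers all of `A ∩ X` except `x`; but `M` matches `A ∩ X` perfectly, so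
    -- both sets would be even.
    have heq : A ∩ X = insert x (N.verts ∩ A) := by
      ext v
      rw [hNv]
      constructor
      · rintro ⟨hvA, hvX⟩
        by_cases hvx : v = x
        · exact Or.inl hvx
        · refine Or.inr ⟨⟨⟨hvX, hAH v hvA⟩, ?_⟩, hvA⟩
          rintro (h | h)
          · exact hvx h
          · exact hyA (h ▸ hvA)
      · rintro (rfl | ⟨hv, hvA⟩)
        · exact ⟨hx, hxX⟩
        · exact ⟨hvA, hv.1.1⟩
    have h1 := hMAX.even_ncard
    rw [heq, Set.ncard_insert_of_notMem, Nat.even_add_one] at h1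
    · exact h1 hNA.even_ncard
    · rw [hNv]
      exact fun h => h.1.2 (Or.inl rfl)
  refine ⟨y, hyA, hyx, ⟨a, mem_of_adj_attachedVerts hyA ha hya, hya⟩, ?_⟩
  have hMAX' := matchesOnto_inter hM.1 (A \ X)
    (fun u v hu h => ⟨hMA u v hu.1 h, fun hv => hu.2 (hMX X hX v u hv h.symm)⟩)
  rw [Set.inter_eq_right.2 (Set.sdiff_subset.trans hAM)] at hMAX'
  -- Use `N` inside `X` and `M` outside it.
  have heq : A \ {x, y} = (N.verts ∩ A) ∪ A \ X := by
    ext v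
    rw [hNv]
    constructor
    · rintro ⟨hvA, hv⟩
      by_cases hvX : v ∈ X
      · exact Or.inl ⟨⟨⟨hvX, hAH v hvA⟩, hv⟩, hvA⟩
      · exact Or.inr ⟨hvA, hvX⟩
    · rintro (⟨hv, hvA⟩ | ⟨hvA, hvX⟩)
      · exact ⟨hvA, hv.2⟩
      · refine ⟨hvA, ?_⟩
        rintro (rfl | rfl)
        · exact hvX hxX
        · exact hvX hyX
  rw [heq]
  refine hNA.union hMAX' (Set.disjoint_left.2 fun v hv hv' => hv'.2 ?_)
  rw [hNv] at hv
  exact hv.1.1.1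

end Basilica

theorem mainTheorem7 {V : Type*} [Finite V] (G : SimpleGraph V)
    (H : Basilica.FactorComponent G) (S : Set V) (hS : S ∈ Basilica.klPartition G H) :
    Basilica.IsFactorCritical
      (Basilica.contractIn G (Basilica.attachedVerts G H S ∪ S) S) :=
  Basilica.isFactorCritical_contractIn_attachedVerts G H S hS.2
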